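/- Let $E$ be a finite-dimensional real inner product space and let $\mathbb B_r(x)$ be the closed ball of radius $r$ about $x$. For nonempty $\Omega\subset E$ let $P_\Omega(x)=\{y\in\Omega:\|x-y\|=\operatorname{dist}(x,\Omega)\}$ and $R_\Omega x=2P_\Omega(x)-x$ (both set-valued). For $x\in\Omega$ let $N^P_\Omega(x)=\{t(u-x): t>0,\ x\in P_\Omega(u)\}$, and let $N_\Omega(x)$ be the set of all limits $\lim_k v_k$ with $v_k\in N^P_\Omega(x_k)$, $x_k\in\Omega$, $x_k\to x$. The Douglas–Rachford operator is $T_{DR}x=\tfrac12(R_AR_Bx+x)$, where $R_AR_Bx=\bigcup_{v\in R_Bx}R_Av$. A set $\Omega$ is *super-regular* at $\hat x$ if for every $\varepsilon>0$ there is $\delta>0$ with $\langle v,y-x\rangle\le\varepsilon\|v\|\|y-x\|$ for all $x,y\in\Omega\cap\mathbb B_\delta(\hat x)$ and $v\in N_\Omega(x)$; it is *$(\varepsilon,\delta)$-regular* at $\hat x$ if this inequality holds for all $x,y\in\Omega\cap\mathbb B_\delta(\hat x)$ and $v\in N^P_\Omega(x)$. The collection $\{A,B\}$ is *strongly regular*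 at $\hat x$ if there are $\alpha,\delta>0$ such that $(A-\omega_1-a_1)\cap(B-\omega_2-a_2)\cap\mathbb B_\rho(0)\ne\emptyset$ for all $\rho\in(0,\delta]$, $\omega_1\in A\cap\mathbb B_\delta(\hat x)$, $\omega_2\in B\cap\mathbb B_\delta(\hat x)$ and $a_1,a_2\in\mathbb B_{\alpha\rho}(0)$. **Theorem.** Let $B\subset E$ be an affine subspace (for instance a linear subspace) and let $A\subset E$ be closed and super-regular at $\hat x\in S:=A\cap B$. Suppose that $\{A,B\}$ is strongly regular at $\hat x$. Consider numbers $\delta_0,\kappa,\varepsilon>0$ and $c\in(0,1)$ such that 1. $\operatorname{dist}(x,S)\le\kappa\max\{\operatorname{dist}(x,A),\operatorname{dist}(x,B)\}$ for all $x\in\mathbb B_{\delta_0}(\hat x)$; 2. $\langle u,v\rangle\ge -c$ for all $z\in A\cap\mathbb B_{\delta_0}(\hat x)$, $y\in B\cap\mathbb B_{\delta_0}(\hat x)$, $u\in N_A(z)\cap\mathbb B_1(0)$, $v\in N_B(y)\cap\mathbb B_1(0)$; 3. $\dfrac{1-c}{\kappa^2}>2\varepsilon+2\varepsilon^2$. Such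 numbers exist, and can be chosen with $1+2\varepsilon+2\varepsilon^2-\frac{1-c}{\kappa^2}\ge0$. For all such numbers there is $\delta\in(0,\delta_0]$ such that $A$ is $(\varepsilon,\delta)$-regular at $\hat x$ and $$\operatorname{dist}(x_+,S)\le\tilde c\,\operatorname{dist}(x,S)\qquad\text{for all }x\in\mathbb B_{\delta/2}(\hat x)\text{ and all }x_+\in T_{DR}x,$$ where $\tilde c=\sqrt{1+2\varepsilon+2\varepsilon^2-\frac{1-c}{\kappa^2}}<1$ (with the convention $\sqrt t=0$ for $t<0$; a negative radicand forces $\kappa<1$, which by 1. happens only if $\hat x$ is an interior point of $S$). -/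

import Mathlib

section DouglasRachford

/-- The metric projector: the set of all best approximations to `x` from `Ω`. -/
def projector {E : Type*} [NormedAddCommGroup E] (Ω : Set E) (x : E) : Set E :=
  {y | y ∈ Ω ∧ ‖x - y‖ = Metric.infDist x Ω}

/-- The set-valued reflector `R_Ω x = 2 P_Ω x - x`. -/
def reflector {E : Type*} [NormedAddCommGroup E] [InnerProductSpace ℝ E]
    (Ω : Set E) (x : E) : Set E :=
  {w | ∃ p ∈ projector Ω x, w = (2 : ℝ) • p - x}

/-- The set-valued Douglas-Rachford operator `T x = (1/2) (R_A R_B x + x)`; the composition of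
set-valued maps is `R_A R_B x = ⋃ v ∈ R_B x, R_A v`. -/
def douglasRachford {E : Type*} [NormedAddCommGroup E] [InnerProductSpace ℝ E]
    (A B : Set E) (x : E) : Set E :=
  {x' | ∃ v ∈ reflector B x, ∃ w ∈ reflector A v, x' = (1 / 2 : ℝ) • (w + x)}

/-- The proximal normal cone `cone (P_Ω⁻¹ x - x)`. -/
def proximalNormalCone {E : Type*} [NormedAddCommGroup E] [InnerProductSpace ℝ E]
    (Ω : Set E) (x : E) : Set E :=
  {v | ∃ t : ℝ, 0 < t ∧ ∃ u : E, x ∈ projector Ω u ∧ v = t • (u - x)}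

/-- The limiting (Mordukhovich) normal cone: limits of proximal normals at points of `Ω`
converging to `x`. -/
def limitingNormalCone {E : Type*} [NormedAddCommGroup E] [InnerProductSpace ℝ E]
    (Ω : Set E) (x : E) : Set E :=
  {v | ∃ (y : ℕ → E) (w : ℕ → E), (∀ k, y k ∈ Ω) ∧ (∀ k, w k ∈ proximalNormalCone Ω (y k)) ∧
    Filter.Tendsto y Filter.atTop (nhds x) ∧ Filter.Tendsto w Filter.atTop (nhds v)}

/-- `Ω` is `(ε, δ)`-subregular at `p` with respect to `S`. For `S = Ω` this is
`(ε, δ)`-regularity of `Ω` at `p`. -/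
def IsSubregularAt {E : Type*} [NormedAddCommGroup E] [InnerProductSpace ℝ E]
    (Ω S : Set E) (ε δ : ℝ) (p : E) : Prop :=
  ∀ x ∈ Metric.closedBall p δ ∩ Ω, ∀ y ∈ S ∩ Metric.closedBall p δ,
    ∀ v ∈ proximalNormalCone Ω x, inner ℝ v (y - x) ≤ ε * ‖v‖ * ‖y - x‖

/-- Super-regularity of `Ω` at `p`. -/
def IsSuperRegularAt {E : Type*} [NormedAddCommGroup E] [InnerProductSpace ℝ E]
    (Ω : Set E) (p : E) : Prop :=
  ∀ ε : ℝ, 0 < ε → ∃ δ : ℝ, 0 < δ ∧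
    ∀ x ∈ Metric.closedBall p δ ∩ Ω, ∀ y ∈ Metric.closedBall p δ ∩ Ω,
      ∀ v ∈ limitingNormalCone Ω x, inner ℝ v (y - x) ≤ ε * ‖v‖ * ‖y - x‖

/-- Strong regularity of the collection `{A, B}` at `p`:
`(A - ω₁ - a₁) ∩ (B - ω₂ - a₂)` meets the ball of radius `ρ` around the origin. -/
def IsStronglyRegularAt {E : Type*} [NormedAddCommGroup E]
    (A B : Set E) (p : E) : Prop :=
  ∃ α : ℝ, 0 < α ∧ ∃ δ : ℝ, 0 < δ ∧ ∀ ρ : ℝ, 0 < ρ → ρ ≤ δ →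
    ∀ ω₁ ∈ A ∩ Metric.closedBall p δ, ∀ ω₂ ∈ B ∩ Metric.closedBall p δ,
      ∀ a₁ ∈ Metric.closedBall (0 : E) (α * ρ), ∀ a₂ ∈ Metric.closedBall (0 : E) (α * ρ),
        (((fun y => y - ω₁ - a₁) '' A ∩ (fun y => y - ω₂ - a₂) '' B) ∩
          Metric.closedBall (0 : E) ρ).Nonempty

/-- Local linear regularity of the collection `{A, B}` at `p` on the closed ball of radius `δ`,
with constant `κ`. -/
def IsLocallyLinearlyRegularAt {E : Type*} [NormedAddCommGroup E]
    (A B : Set E) (p : E) (δ κ : ℝ) : Prop :=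
  ∀ x ∈ Metric.closedBall p δ,
    Metric.infDist x (A ∩ B) ≤ κ * max (Metric.infDist x A) (Metric.infDist x B)

/-- The angle condition with constant `c` on the closed ball of radius `δ` around `p`: normals of
norm at most one to `A` and to `B` at points of that ball satisfy `⟨u, v⟩ ≥ -c`. -/
def NormalAngleCondition {E : Type*} [NormedAddCommGroup E] [InnerProductSpace ℝ E]
    (A B : Set E) (p : E) (δ c : ℝ) : Prop :=
  ∀ z ∈ A ∩ Metric.closedBall p δ, ∀ u ∈ limitingNormalCone A z ∩ Metric.closedBall (0 : E) 1,
    ∀ y ∈ B ∩ Metric.closedBall p δ, ∀ v ∈ limitingNormalCone B y ∩ Metric.closedBall (0 : E) 1,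
      -c ≤ inner ℝ u v

end DouglasRachford

/-!
The theorem has two independent halves, each read off directly from the definitions.

*Admissible constants.* In the definition of strong regularity with constant `α`, the choice
`aᵢ = x - ωᵢ`, where `ω₁`, `ω₂` are nearest points of `A`, `B` to `x`, produces a point of `A ∩ B`
within `α⁻¹ max (d(x, A)) (d(x, B))` of `x`. This is linear regularity with `κ = α⁻¹`
(`StrongRegularWith.isLocallyLinearlyRegularAt`). The choice `a₁ = αρ u`, `a₂ = αρ v` for unit proximal normals
`u`, `v`, together with the quadratic inequality for proximal normals, gives `2α ≤ ‖u + v‖` as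
`ρ → 0`, that is `⟨u, v⟩ ≥ -(1 - 2α²)`; this bound is homogeneous and passes to limiting normals
(`StrongRegularWith.angle_proximal`, `StrongRegularWith.angle_limiting`).

*Contraction.* For `x₊ ∈ T x` let `b` be the projection of `x` on `B`, `v = 2b - x`, `a` the chosen
projection of `v` on `A`, and put `m = x - b`, `n = v - a`, so that `x₊ = x + a - b`. For a nearest
point `s` of `A ∩ B` to `x` the identity
`‖x₊ - s‖² = ‖x - s‖² - ‖m‖² - ‖n‖² - 2⟨n, m⟩ + 2⟨n, s - a⟩` holds. The angle condition bounds the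
middle terms by `-(1 - c)(‖m‖² + ‖n‖²)`. Reflection in `B` preserves the distance to every point of
`B`, so linear regularity may be applied at `v`, where the distances to `A` and `B` are `‖n‖` and
`‖m‖`; this gives `d(x, A ∩ B)² ≤ κ²(‖m‖² + ‖n‖²)`. Regularity of `A` with
a constant `η ≤ 1/2` bounds the last term by `2η‖x - s‖²` (`infDist_sq_douglasRachford_le`);
super-regularity supplies `η = min ε (1/2)`.
-/

open Metric Filter Topology

section ContractionOfDouglasRachford

/-! ### Projections and proximal normals -/

lemma norm_sub_le_of_mem_projector {E : Type*} [NormedAddCommGroup E] {Ω : Set E} {x y z : E}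
    (hy : y ∈ projector Ω x) (hz : z ∈ Ω) : ‖x - y‖ ≤ ‖x - z‖ := by
  rw [hy.2, ← dist_eq_norm]
  exact infDist_le_dist_of_mem hz

variable {E : Type*} [NormedAddCommGroup E] [InnerProductSpace ℝ E]

lemma smul_mem_proximalNormalCone {Ω : Set E} {x v : E} (hv : v ∈ proximalNormalCone Ω x)
    {r : ℝ} (hr : 0 < r) : r • v ∈ proximalNormalCone Ω x := by
  obtain ⟨t, ht, u, hu, rfl⟩ := hv
  exact ⟨r * t, mul_pos hr ht, u, hu, smul_smul _ _ _⟩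

lemma sub_mem_proximalNormalCone {Ω : Set E} {x u : E} (hx : x ∈ projector Ω u) :
    u - x ∈ proximalNormalCone Ω x :=
  ⟨1, one_pos, u, hx, (one_smul _ _).symm⟩

lemma proximalNormalCone_subset_limitingNormalCone {Ω : Set E} {x : E} (hx : x ∈ Ω) :
    proximalNormalCone Ω x ⊆ limitingNormalCone Ω x := fun v hv =>
  ⟨fun _ => x, fun _ => v, fun _ => hx, fun _ => hv, tendsto_const_nhds, tendsto_const_nhds⟩

/-- The quadratic inequality for proximal normals: the ball around a point projecting to `x`
lies outside `Ω`. -/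
lemma exists_inner_le_mul_sq_of_mem_proximalNormalCone {Ω : Set E} {x v : E}
    (hv : v ∈ proximalNormalCone Ω x) :
    ∃ σ : ℝ, 0 < σ ∧ ∀ y ∈ Ω, inner ℝ v (y - x) ≤ σ * ‖y - x‖ ^ 2 := by
  obtain ⟨t, ht, u, hu, rfl⟩ := hv
  refine ⟨t / 2, by positivity, fun y hy => ?_⟩
  have h := norm_sub_le_of_mem_projector hu hy
  have h2 : ‖u - y‖ ^ 2 = ‖u - x‖ ^ 2 - 2 * inner ℝ (u - x) (y - x) + ‖y - x‖ ^ 2 := by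
    rw [← norm_sub_sq_real, sub_sub_sub_cancel_right]
  have h3 : ‖u - x‖ ^ 2 ≤ ‖u - y‖ ^ 2 := by gcongr
  rw [real_inner_smul_left]
  nlinarith

/-- The residual of the projection on an affine subspace is orthogonal to the subspace. -/
lemma inner_sub_eq_zero_of_mem_projector_affineSubspace {B : AffineSubspace ℝ E} {x b y : E}
    (hb : b ∈ projector (B : Set E) x) (hy : y ∈ B) : inner ℝ (x - b) (y - b) = 0 := by
  have key : ∀ t : ℝ, 0 ≤ ‖y - b‖ ^ 2 * (t * t) + (-2 * inner ℝ (x - b) (y - b)) * t + 0 := by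
    intro t
    have hm : t • (y - b) + b ∈ (B : Set E) := by
      simpa [AffineMap.lineMap_apply] using AffineMap.lineMap_mem (k := ℝ) t hb.1 hy
    have h := norm_sub_le_of_mem_projector hb hm
    have h2 : ‖x - b‖ ^ 2 ≤ ‖x - (t • (y - b) + b)‖ ^ 2 := by gcongr
    have h3 : x - (t • (y - b) + b) = (x - b) - t • (y - b) := by abel
    rw [h3, norm_sub_sq_real (x - b) (t • (y - b)), real_inner_smul_right, norm_smul, mul_pow, Real.norm_eq_abs,
      sq_abs] at h2
    nlinarith
  have := discrim_le_zero key
  rw [discrim] at this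
  nlinarith [sq_nonneg (inner ℝ (x - b) (y - b))]

/-! ### Consequences of strong regularity -/

/-- Strong regularity of `{A, B}` at `p` with the constants `α`, `δ` exposed, and with the common
point of the two translates named by `g`. -/
def StrongRegularWith {E : Type*} [NormedAddCommGroup E] (A B : Set E) (p : E) (α δ : ℝ) : Prop :=
  ∀ ρ : ℝ, 0 < ρ → ρ ≤ δ → ∀ ω₁ ∈ A ∩ closedBall p δ, ∀ ω₂ ∈ B ∩ closedBall p δ,
    ∀ a₁ a₂ : E, ‖a₁‖ ≤ α * ρ → ‖a₂‖ ≤ α * ρ →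
      ∃ g : E, g + a₁ + ω₁ ∈ A ∧ g + a₂ + ω₂ ∈ B ∧ ‖g‖ ≤ ρ

lemma IsStronglyRegularAt.exists_strongRegularWith {E : Type*} [NormedAddCommGroup E]
    {A B : Set E} {p : E} (h : IsStronglyRegularAt A B p) :
    ∃ α δ : ℝ, 0 < α ∧ α ≤ 1 / 2 ∧ 0 < δ ∧ StrongRegularWith A B p α δ := by
  obtain ⟨α, hα, δ, hδ, h⟩ := h
  refine ⟨min α (1 / 2), δ, by positivity, min_le_right _ _, hδ, ?_⟩
  intro ρ hρ hρδ ω₁ hω₁ ω₂ hω₂ a₁ a₂ ha₁ ha₂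
  have hle : min α (1 / 2) * ρ ≤ α * ρ := by gcongr; exact min_le_left _ _
  obtain ⟨g, ⟨⟨y₁, hy₁, e₁⟩, ⟨y₂, hy₂, e₂⟩⟩, hg⟩ := h ρ hρ hρδ ω₁ hω₁ ω₂ hω₂
    a₁ (by simpa using ha₁.trans hle) a₂ (by simpa using ha₂.trans hle)
  refine ⟨g, ?_, ?_, by simpa using hg⟩
  · rw [← e₁]; simpa using hy₁
  · rw [← e₂]; simpa using hy₂

/-- Strong regularity implies local linear regularity with constant `α⁻¹`: move the nearest points
of both sets to `x`. -/
lemma StrongRegularWith.isLocallyLinearlyRegularAt [FiniteDimensional ℝ E] {A B : Set E} {p : E}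
    {α δ δ₀ : ℝ} (h : StrongRegularWith A B p α δ) (hA : IsClosed A) (hB : IsClosed B)
    (hp : p ∈ A ∩ B) (hα : 0 < α) (h₁ : δ₀ ≤ α * δ) (h₂ : 2 * δ₀ ≤ δ) :
    IsLocallyLinearlyRegularAt A B p δ₀ α⁻¹ := by
  intro x hx
  obtain ⟨ω₁, hω₁, e₁⟩ := hA.exists_infDist_eq_dist ⟨p, hp.1⟩ x
  obtain ⟨ω₂, hω₂, e₂⟩ := hB.exists_infDist_eq_dist ⟨p, hp.2⟩ x
  rw [mem_closedBall] at hx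
  have d₁ : dist x ω₁ ≤ dist x p := e₁ ▸ infDist_le_dist_of_mem hp.1
  have d₂ : dist x ω₂ ≤ dist x p := e₂ ▸ infDist_le_dist_of_mem hp.2
  rw [e₁, e₂]
  set M := max (dist x ω₁) (dist x ω₂) with hM
  have hM₁ : dist x ω₁ ≤ M := le_max_left _ _
  have hM₂ : dist x ω₂ ≤ M := le_max_right _ _
  have hMδ : M ≤ α * δ := (max_le d₁ d₂).trans (hx.trans h₁)
  rcases (dist_nonneg.trans hM₁).eq_or_lt with h0 | h0
  · have x₁ : x = ω₁ := dist_le_zero.1 (h0 ▸ hM₁)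
    have x₂ : x = ω₂ := dist_le_zero.1 (h0 ▸ hM₂)
    rw [← h0, infDist_zero_of_mem (show x ∈ A ∩ B from ⟨x₁ ▸ hω₁, x₂ ▸ hω₂⟩), mul_zero]
  · have b₁ : dist ω₁ p ≤ δ := by linarith [dist_triangle_left ω₁ p x]
    have b₂ : dist ω₂ p ≤ δ := by linarith [dist_triangle_left ω₂ p x]
    have hαM : α * (α⁻¹ * M) = M := by field_simp
    obtain ⟨g, hgA, hgB, hg⟩ := h (α⁻¹ * M) (by positivity)
      (by rw [inv_mul_le_iff₀ hα]; exact hMδ) ω₁ ⟨hω₁, b₁⟩ ω₂ ⟨hω₂, b₂⟩ (x - ω₁) (x - ω₂)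
      (by rwa [hαM, ← dist_eq_norm]) (by rwa [hαM, ← dist_eq_norm])
    have k₁ : g + (x - ω₁) + ω₁ = g + x := by abel
    have k₂ : g + (x - ω₂) + ω₂ = g + x := by abel
    rw [k₁] at hgA
    rw [k₂] at hgB
    calc infDist x (A ∩ B) ≤ dist x (g + x) := infDist_le_dist_of_mem ⟨hgA, hgB⟩
      _ = ‖g‖ := by simp
      _ ≤ α⁻¹ * M := hg

/-- Unit proximal normals to `A` and `B` near `p` are uniformly far from being opposite. -/
lemma StrongRegularWith.two_mul_le_norm_add {A B : Set E} {p : E} {α δ : ℝ}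
    (h : StrongRegularWith A B p α δ) (hα : 0 < α) (hδ : 0 < δ) {z y u v : E}
    (hz : z ∈ A ∩ closedBall p δ) (hy : y ∈ B ∩ closedBall p δ)
    (hu : u ∈ proximalNormalCone A z) (hv : v ∈ proximalNormalCone B y)
    (hu1 : ‖u‖ = 1) (hv1 : ‖v‖ = 1) : 2 * α ≤ ‖u + v‖ := by
  obtain ⟨σ, hσ, hσA⟩ := exists_inner_le_mul_sq_of_mem_proximalNormalCone hu
  obtain ⟨τ, hτ, hτB⟩ := exists_inner_le_mul_sq_of_mem_proximalNormalCone hv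
  set K := (σ + τ) * (1 + α) ^ 2 with hK
  have hK0 : 0 < K := by positivity
  have key : ∀ ρ : ℝ, 0 < ρ → ρ ≤ δ → 2 * α ≤ ‖u + v‖ + K * ρ := by
    intro ρ hρ hρδ
    have hs : ∀ w : E, ‖w‖ = 1 → ‖(α * ρ) • w‖ = α * ρ := fun w hw => by
      rw [norm_smul, hw, mul_one, Real.norm_of_nonneg (by positivity)]
    obtain ⟨g, hgA, hgB, hg⟩ := h ρ hρ hρδ z hz y hy ((α * ρ) • u) ((α * ρ) • v)
      (hs u hu1).le (hs v hv1).le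
    have hb : ∀ w : E, ‖w‖ = 1 → ‖g + (α * ρ) • w‖ ^ 2 ≤ ((1 + α) * ρ) ^ 2 := fun w hw => by
      have := norm_add_le g ((α * ρ) • w)
      rw [hs w hw] at this
      gcongr
      linarith
    have i₁ := hσA _ hgA
    have i₂ := hτB _ hgB
    rw [add_sub_cancel_right] at i₁ i₂
    have j₁ := i₁.trans (mul_le_mul_of_nonneg_left (hb u hu1) hσ.le)
    have j₂ := i₂.trans (mul_le_mul_of_nonneg_left (hb v hv1) hτ.le)
    rw [inner_add_right, real_inner_smul_right, real_inner_self_eq_norm_sq, hu1] at j₁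
    rw [inner_add_right, real_inner_smul_right, real_inner_self_eq_norm_sq, hv1] at j₂
    have hcs : -(‖u + v‖ * ρ) ≤ inner ℝ u g + inner ℝ v g := by
      rw [← inner_add_left]
      have := (abs_le.1 (abs_real_inner_le_norm (u + v) g)).1
      nlinarith [mul_le_mul_of_nonneg_left hg (norm_nonneg (u + v))]
    have : 2 * α * ρ ≤ (‖u + v‖ + K * ρ) * ρ := by rw [hK]; nlinarith
    exact le_of_mul_le_mul_right this hρ
  by_contra! hlt
  have hgap : 0 < (2 * α - ‖u + v‖) / (2 * K) := div_pos (by linarith) (by positivity)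
  have h1 := key (min δ ((2 * α - ‖u + v‖) / (2 * K))) (lt_min hδ hgap) (min_le_left _ _)
  have h2 : K * min δ ((2 * α - ‖u + v‖) / (2 * K)) ≤ K * ((2 * α - ‖u + v‖) / (2 * K)) := by
    gcongr
    exact min_le_right _ _
  have h3 : K * ((2 * α - ‖u + v‖) / (2 * K)) = (2 * α - ‖u + v‖) / 2 := by field_simp
  linarith

lemma StrongRegularWith.angle_proximal {A B : Set E} {p : E} {α δ : ℝ}
    (h : StrongRegularWith A B p α δ) (hα : 0 < α) (hδ : 0 < δ) {z y u v : E}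
    (hz : z ∈ A ∩ closedBall p δ) (hy : y ∈ B ∩ closedBall p δ)
    (hu : u ∈ proximalNormalCone A z) (hv : v ∈ proximalNormalCone B y) :
    -(1 - 2 * α ^ 2) * (‖u‖ * ‖v‖) ≤ inner ℝ u v := by
  rcases eq_or_ne u 0 with rfl | hu0
  · simp
  rcases eq_or_ne v 0 with rfl | hv0
  · simp
  have nu := norm_pos_iff.2 hu0
  have nv := norm_pos_iff.2 hv0
  have hu1 : ‖‖u‖⁻¹ • u‖ = 1 := norm_smul_inv_norm hu0
  have hv1 : ‖‖v‖⁻¹ • v‖ = 1 := norm_smul_inv_norm hv0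
  have key := h.two_mul_le_norm_add hα hδ hz hy
    (smul_mem_proximalNormalCone hu (inv_pos.2 nu))
    (smul_mem_proximalNormalCone hv (inv_pos.2 nv)) hu1 hv1
  have hsq : (2 * α) ^ 2 ≤ ‖‖u‖⁻¹ • u + ‖v‖⁻¹ • v‖ ^ 2 := by gcongr
  rw [norm_add_sq_real, hu1, hv1, real_inner_smul_left, real_inner_smul_right] at hsq
  have e : inner ℝ u v = (‖u‖⁻¹ * (‖v‖⁻¹ * inner ℝ u v)) * (‖u‖ * ‖v‖) := by field_simp
  rw [e]
  gcongr
  linarith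

lemma StrongRegularWith.angle_limiting {A B : Set E} {p : E} {α δ δ₀ : ℝ}
    (h : StrongRegularWith A B p α δ) (hα : 0 < α) (hα2 : α ≤ 1 / 2) (hδ : 0 < δ)
    (hlt : δ₀ < δ) : NormalAngleCondition A B p δ₀ (1 - 2 * α ^ 2) := by
  rintro z ⟨-, hz⟩ u ⟨⟨zk, uk, hzk, huk, tz, tu⟩, hu1⟩ y ⟨-, hy⟩ v
    ⟨⟨yk, vk, hyk, hvk, ty, tv⟩, hv1⟩
  have ez : ∀ᶠ k in atTop, zk k ∈ closedBall p δ :=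
    tz.eventually (closedBall_mem_nhds_of_mem (closedBall_subset_ball hlt hz))
  have ey : ∀ᶠ k in atTop, yk k ∈ closedBall p δ :=
    ty.eventually (closedBall_mem_nhds_of_mem (closedBall_subset_ball hlt hy))
  have hlim : -(1 - 2 * α ^ 2) * (‖u‖ * ‖v‖) ≤ inner ℝ u v := by
    refine le_of_tendsto_of_tendsto ((tu.norm.mul tv.norm).const_mul _) (tu.inner tv) ?_
    filter_upwards [ez, ey] with k hk hk'
    exact h.angle_proximal hα hδ ⟨hzk k, hk⟩ ⟨hyk k, hk'⟩ (huk k) (hvk k)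
  rw [mem_closedBall_zero_iff] at hu1 hv1
  have hprod : ‖u‖ * ‖v‖ ≤ 1 := mul_le_one₀ hu1 (norm_nonneg _) hv1
  have hc : 0 ≤ 1 - 2 * α ^ 2 := by nlinarith
  nlinarith

/-! ### The contraction estimate -/

/-- The angle condition in homogeneous form, for proximal normals of arbitrary length. -/
lemma NormalAngleCondition.neg_mul_norm_mul_norm_le {A B : Set E} {p : E} {δ c : ℝ}
    (h : NormalAngleCondition A B p δ c) {z y u v : E}
    (hz : z ∈ A ∩ closedBall p δ) (hy : y ∈ B ∩ closedBall p δ)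
    (hu : u ∈ proximalNormalCone A z) (hv : v ∈ proximalNormalCone B y) :
    -c * (‖u‖ * ‖v‖) ≤ inner ℝ u v := by
  rcases eq_or_ne u 0 with rfl | hu0
  · simp
  rcases eq_or_ne v 0 with rfl | hv0
  · simp
  have nu := norm_pos_iff.2 hu0
  have nv := norm_pos_iff.2 hv0
  have hu1 : ‖‖u‖⁻¹ • u‖ = 1 := norm_smul_inv_norm hu0
  have hv1 : ‖‖v‖⁻¹ • v‖ = 1 := norm_smul_inv_norm hv0
  have key := h z hz (‖u‖⁻¹ • u)
    ⟨proximalNormalCone_subset_limitingNormalCone hz.1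
      (smul_mem_proximalNormalCone hu (inv_pos.2 nu)), mem_closedBall_zero_iff.2 hu1.le⟩
    y hy (‖v‖⁻¹ • v)
    ⟨proximalNormalCone_subset_limitingNormalCone hy.1
      (smul_mem_proximalNormalCone hv (inv_pos.2 nv)), mem_closedBall_zero_iff.2 hv1.le⟩
  rw [real_inner_smul_left, real_inner_smul_right] at key
  have e : inner ℝ u v = (‖u‖⁻¹ * (‖v‖⁻¹ * inner ℝ u v)) * (‖u‖ * ‖v‖) := by field_simp
  rw [e]
  gcongr

lemma norm_reflection_sub {B : AffineSubspace ℝ E} {x b y : E}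
    (hb : b ∈ projector (B : Set E) x) (hy : y ∈ B) : ‖(2 : ℝ) • b - x - y‖ = ‖x - y‖ := by
  have h0 := inner_sub_eq_zero_of_mem_projector_affineSubspace hb hy
  have e₁ : (2 : ℝ) • b - x - y = -((x - b) + (y - b)) := by rw [two_smul]; abel
  have e₂ : x - y = (x - b) - (y - b) := by abel
  rw [e₁, e₂, norm_neg, ← sq_eq_sq₀ (norm_nonneg _) (norm_nonneg _), norm_add_sq_real,
    norm_sub_sq_real (x - b) (y - b), h0]
  ring

lemma infDist_reflection {B : AffineSubspace ℝ E} {x b : E}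
    (hb : b ∈ projector (B : Set E) x) {S : Set E} (hS : S ⊆ B) :
    infDist ((2 : ℝ) • b - x) S = infDist x S := by
  have (y : S) : dist ((2 : ℝ) • b - x) y = dist x y := by
    simpa only [dist_eq_norm] using norm_reflection_sub hb (hS y.2)
  simp only [infDist_eq_iInf, this]

/-- The contraction estimate in squared form. It needs `A` to be regular only up to a constant
`η ≤ 1/2`. -/
lemma infDist_sq_douglasRachford_le [FiniteDimensional ℝ E] {A : Set E} {B : AffineSubspace ℝ E}
    {p : E} (hA : IsClosed A) (hp : p ∈ A ∩ (B : Set E)) {δ κ c η : ℝ} (hκ : 0 < κ)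
    (hc : c ∈ Set.Ioo (0 : ℝ) 1) (hη : 0 < η) (hη2 : η ≤ 1 / 2)
    (hlin : IsLocallyLinearlyRegularAt A (B : Set E) p δ κ)
    (hang : NormalAngleCondition A (B : Set E) p δ c) (hreg : IsSubregularAt A A η δ p)
    {x x' : E} (hx : x ∈ closedBall p (δ / 2)) (hx' : x' ∈ douglasRachford A (B : Set E) x) :
    infDist x' (A ∩ (B : Set E)) ^ 2 ≤
      (1 + 2 * η - (1 - c) / κ ^ 2) * infDist x (A ∩ (B : Set E)) ^ 2 := by
  obtain ⟨v, ⟨b, hb, hv⟩, w, ⟨a, ha, rfl⟩, rfl⟩ := hx'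
  have hS : IsClosed (A ∩ (B : Set E)) := hA.inter B.closed_of_finiteDimensional
  obtain ⟨s, hs, hds⟩ := hS.exists_infDist_eq_dist ⟨p, hp⟩ x
  rw [mem_closedBall, dist_eq_norm] at hx
  have hδ : 0 ≤ δ := by linarith [norm_nonneg (x - p)]
  have hvp : ‖v - p‖ ≤ δ / 2 := by rwa [hv, norm_reflection_sub hb hp.2]
  have hvs : ‖v - s‖ = ‖x - s‖ := by rw [hv, norm_reflection_sub hb hs.2]
  have hxs : ‖x - s‖ ≤ δ / 2 := by
    rw [← dist_eq_norm, ← hds]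
    exact (infDist_le_dist_of_mem hp).trans (by rwa [dist_eq_norm])
  have hva : ‖v - a‖ ≤ ‖v - p‖ := norm_sub_le_of_mem_projector ha hp.1
  have hxb : ‖x - b‖ ≤ ‖x - p‖ := norm_sub_le_of_mem_projector hb hp.2
  have ball : ∀ {q y : E}, ‖q - p‖ ≤ δ / 2 → ‖q - y‖ ≤ δ / 2 → y ∈ closedBall p δ := by
    intro q y h₁ h₂
    rw [← dist_eq_norm] at h₁ h₂
    rw [mem_closedBall]
    linarith [dist_triangle_left y p q]
  have has : a ∈ closedBall p δ := ball hvp (hva.trans hvp)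
  have hbs : b ∈ closedBall p δ := ball hx (hxb.trans hx)
  have hss : s ∈ closedBall p δ := ball hx hxs
  have hvs' : v ∈ closedBall p δ := by
    rw [mem_closedBall, dist_eq_norm]
    linarith
  have hna : v - a ∈ proximalNormalCone A a := sub_mem_proximalNormalCone ha
  have hnb : x - b ∈ proximalNormalCone (B : Set E) b := sub_mem_proximalNormalCone hb
  have hr := hreg a ⟨has, ha.1⟩ s ⟨hs.1, hss⟩ _ hna
  have hθ := hang.neg_mul_norm_mul_norm_le ⟨ha.1, has⟩ ⟨hb.1, hbs⟩ hna hnb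
  -- Linear regularity is applied at the reflected point, whose distances to `A`, `B` are the
  -- lengths of the two normals.
  have hl := hlin v hvs'
  have hvB : infDist v (B : Set E) = ‖x - b‖ := by
    rw [hv, infDist_reflection hb subset_rfl, hb.2]
  rw [hv, infDist_reflection hb Set.inter_subset_right, ← hv, hvB, ← ha.2, hds, dist_eq_norm] at hl
  have horth := inner_sub_eq_zero_of_mem_projector_affineSubspace hb hs.2
  have hle : infDist ((1 / 2 : ℝ) • ((2 : ℝ) • a - v + x)) (A ∩ (B : Set E)) ^ 2 ≤
      ‖(1 / 2 : ℝ) • ((2 : ℝ) • a - v + x) - s‖ ^ 2 := by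
    gcongr
    · exact infDist_nonneg
    · rw [← dist_eq_norm]
      exact infDist_le_dist_of_mem hs
  rw [hds, dist_eq_norm]
  refine hle.trans ?_
  have hbv : b = (1 / 2 : ℝ) • (v + x) := by
    rw [hv, sub_add_cancel, smul_smul]
    norm_num
  have eB : (1 / 2 : ℝ) • ((2 : ℝ) • a - v + x) - s = (x - s) + (a - b) := by rw [hbv]; module
  set m := x - b with hm
  set n := v - a with hn
  -- Everything is expressed through `m`, `n` and `q = s - a`.
  set q := s - a with hq
  have e₁ : (x - s) + (a - b) = m - q := by rw [hm, hq]; abel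
  have e₂ : x - s = (2 : ℝ) • m + n - q := by rw [hm, hn, hq, hbv]; module
  have e₃ : s - b = q - m - n := by rw [hm, hn, hq, hbv]; module
  have e₄ : v - s = n - q := by rw [hn, hq]; abel
  have hvq : ‖x - s‖ ^ 2 = ‖n‖ ^ 2 - 2 * inner ℝ n q + ‖q‖ ^ 2 := by
    rw [← hvs, e₄, norm_sub_sq_real]
  rw [e₃, inner_sub_right, inner_sub_right, real_inner_self_eq_norm_sq, real_inner_comm n m]
    at horth
  rw [eB, e₁, norm_sub_sq_real]
  set d := ‖x - s‖ with hd
  -- Expanding `‖v - s‖ ^ 2 = ‖n - q‖ ^ 2` and using regularity once more bounds `‖n‖ * ‖q‖`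
  -- itself; this is where `η ≤ 1 / 2` enters.
  rw [mul_assoc] at hr
  have hNq : ‖n‖ * ‖q‖ ≤ d ^ 2 := by
    have h1 : η * (‖n‖ * ‖q‖) ≤ 1 / 2 * (‖n‖ * ‖q‖) := by gcongr
    linarith [two_mul_le_add_sq ‖n‖ ‖q‖]
  have hsum : ‖m‖ ^ 2 - 2 * inner ℝ m q + ‖q‖ ^ 2 =
      d ^ 2 - ‖m‖ ^ 2 - ‖n‖ ^ 2 - 2 * inner ℝ n m + 2 * inner ℝ n q := by
    linarith
  have hκd : (1 - c) / κ ^ 2 * d ^ 2 ≤ (1 - c) * (‖m‖ ^ 2 + ‖n‖ ^ 2) := by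
    have h1 : d ^ 2 ≤ κ ^ 2 * (‖m‖ ^ 2 + ‖n‖ ^ 2) := by
      calc d ^ 2 ≤ (κ * max ‖n‖ ‖m‖) ^ 2 := by gcongr
        _ = κ ^ 2 * max ‖n‖ ‖m‖ ^ 2 := mul_pow _ _ _
        _ ≤ κ ^ 2 * (‖m‖ ^ 2 + ‖n‖ ^ 2) := by
          gcongr
          rcases max_choice ‖n‖ ‖m‖ with h | h <;> rw [h] <;>
            nlinarith [sq_nonneg ‖n‖, sq_nonneg ‖m‖]
    have h2 : 0 ≤ 1 - c := by linarith [hc.2]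
    calc (1 - c) / κ ^ 2 * d ^ 2 ≤ (1 - c) / κ ^ 2 * (κ ^ 2 * (‖m‖ ^ 2 + ‖n‖ ^ 2)) := by gcongr
      _ = (1 - c) * (‖m‖ ^ 2 + ‖n‖ ^ 2) := by field_simp
  have hηd : 2 * inner ℝ n q ≤ 2 * η * d ^ 2 := by
    linarith [mul_le_mul_of_nonneg_left hNq hη.le]
  have hcs : (1 - c) * (‖m‖ ^ 2 + ‖n‖ ^ 2) ≤ ‖m‖ ^ 2 + ‖n‖ ^ 2 + 2 * inner ℝ n m := by
    nlinarith [mul_nonneg hc.1.le (sq_nonneg (‖n‖ - ‖m‖))]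
  rw [hsum]
  linarith

end ContractionOfDouglasRachford

theorem mainTheorem1 {E : Type*} [NormedAddCommGroup E] [InnerProductSpace ℝ E]
    [FiniteDimensional ℝ E] (A : Set E) (B : AffineSubspace ℝ E) (p : E)
    (hA : IsClosed A) (hp : p ∈ A ∩ (B : Set E)) (hsuper : IsSuperRegularAt A p)
    (hstrong : IsStronglyRegularAt A (B : Set E) p) :
    -- admissible constants exist
    (∃ δ₀ κ c ε : ℝ, 0 < δ₀ ∧ 0 < κ ∧ c ∈ Set.Ioo (0 : ℝ) 1 ∧ 0 < ε ∧
      IsLocallyLinearlyRegularAt A (B : Set E) p δ₀ κ ∧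
      NormalAngleCondition A (B : Set E) p δ₀ c ∧
      2 * ε + 2 * ε ^ 2 < (1 - c) / κ ^ 2 ∧
      0 ≤ 1 + 2 * ε + 2 * ε ^ 2 - (1 - c) / κ ^ 2) ∧
    -- and all of them give the contraction near `p`
    (∀ δ₀ κ c ε : ℝ, 0 < δ₀ → 0 < κ → c ∈ Set.Ioo (0 : ℝ) 1 → 0 < ε →
      IsLocallyLinearlyRegularAt A (B : Set E) p δ₀ κ →
      NormalAngleCondition A (B : Set E) p δ₀ c →
      2 * ε + 2 * ε ^ 2 < (1 - c) / κ ^ 2 →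
      ∃ δ : ℝ, 0 < δ ∧ δ ≤ δ₀ ∧ IsSubregularAt A A ε δ p ∧
        Real.sqrt (1 + 2 * ε + 2 * ε ^ 2 - (1 - c) / κ ^ 2) < 1 ∧
        ∀ x ∈ Metric.closedBall p (δ / 2), ∀ x' ∈ douglasRachford A (B : Set E) x,
          Metric.infDist x' (A ∩ (B : Set E)) ≤
            Real.sqrt (1 + 2 * ε + 2 * ε ^ 2 - (1 - c) / κ ^ 2) *
              Metric.infDist x (A ∩ (B : Set E))) := by
  constructor
  · obtain ⟨α, δ, hα, hα2, hδ, h⟩ := hstrong.exists_strongRegularWith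
    have hB : IsClosed (B : Set E) := B.closed_of_finiteDimensional
    have hc : 0 < 1 - 2 * α ^ 2 := by nlinarith
    -- With `κ = α⁻¹` and `c = 1 - 2 α ^ 2` the quotient `(1 - c) / κ ^ 2` is `2 α ^ 4`.
    have e : (1 - (1 - 2 * α ^ 2)) / α⁻¹ ^ 2 = 2 * α ^ 4 := by field_simp; ring
    have hα4 : 0 < α ^ 4 := by positivity
    have hα41 : α ^ 4 ≤ 1 / 16 := by
      calc α ^ 4 ≤ (1 / 2) ^ 4 := by gcongr
        _ = 1 / 16 := by norm_num
    refine ⟨α * δ / 2, α⁻¹, 1 - 2 * α ^ 2, α ^ 4 / 2, by positivity, by positivity,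
      ⟨hc, by nlinarith [sq_pos_of_pos hα]⟩, by positivity,
      h.isLocallyLinearlyRegularAt hA hB hp hα (by nlinarith [mul_pos hα hδ]) (by nlinarith),
      h.angle_limiting hα hα2 hδ (by nlinarith), ?_, ?_⟩
    · rw [e]
      nlinarith
    · rw [e]
      nlinarith
  · intro δ₀ κ c ε hδ₀ hκ hc hε hlin hang hlt
    -- Super-regularity allows a regularity constant smaller than `ε`, which makes the estimate
    -- hold for large `ε` too.
    obtain ⟨δ₁, hδ₁, hsup⟩ := hsuper (min ε (1 / 2)) (by positivity)
    have hreg : IsSubregularAt A A (min ε (1 / 2)) (min δ₀ δ₁) p := fun x hx y hy v hv =>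
      hsup x ⟨closedBall_subset_closedBall (min_le_right _ _) hx.1, hx.2⟩
        y ⟨closedBall_subset_closedBall (min_le_right _ _) hy.2, hy.1⟩ v
        (proximalNormalCone_subset_limitingNormalCone hx.2 hv)
    have hball := closedBall_subset_closedBall (x := p) (min_le_left δ₀ δ₁)
    refine ⟨min δ₀ δ₁, lt_min hδ₀ hδ₁, min_le_left _ _, fun x hx y hy v hv => ?_, ?_,
      fun x hx x' hx' => ?_⟩
    · refine (hreg x hx y hy v hv).trans ?_
      gcongr
      exact min_le_left _ _
    · rw [Real.sqrt_lt' one_pos]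
      linarith
    · have key := infDist_sq_douglasRachford_le hA hp hκ hc (by positivity) (min_le_right ε (1 / 2))
        (fun x hx => hlin x (hball hx))
        (fun z hz u hu y hy v hv => hang z ⟨hz.1, hball hz.2⟩ u hu y ⟨hy.1, hball hy.2⟩ v hv)
        hreg hx hx'
      have hle : infDist x' (A ∩ (B : Set E)) ^ 2 ≤
          (1 + 2 * ε + 2 * ε ^ 2 - (1 - c) / κ ^ 2) * infDist x (A ∩ (B : Set E)) ^ 2 := by
        refine key.trans (mul_le_mul_of_nonneg_right ?_ (sq_nonneg _))
        linarith [min_le_left ε (1 / 2), sq_nonneg ε]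
      -- `Real.sqrt` splits over the product even if the first factor is negative.
      calc infDist x' (A ∩ (B : Set E)) ≤ _ := Real.le_sqrt_of_sq_le hle
        _ = _ := by rw [Real.sqrt_mul' _ (sq_nonneg _), Real.sqrt_sq infDist_nonneg]
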